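/- Let $\beta,\kappa:\mathbb{Z}^+\to\mathbb{Z}_{\ge 0}$ be functions. Let $M$ be a matroid of rank $n$ with ground set $E(M)$, whose girth $g$ (the size of a smallest circuit of $M$, with $g=\infty$ if $M$ has no circuit) satisfies $g\ge n-\beta(n)+1$. Let $\mathcal{B}=(B_1,\dots,B_n)$ be a sequence of (not necessarily distinct) bases of $M$ which is $\kappa$-overlapping, that is, no element of $E(M)$ lies in more than $\kappa(n)$ of the bases $B_1,\dots,B_n$; we regard $B_c$ as having colour $c$. A rainbow base is a base $\{x_1,\dots,x_n\}$ of $M$ together with an assignment of representatives, where $x_c\in B_c$ represents the colour $c$ and $x_1,\dots,x_n$ are distinct. Rainbow bases are disjoint if for each colour $c$ their representatives of colour $c$ are distinct. Let $t(\mathcal{B})$ be the largest cardinality of a set of pairwise disjoint rainbow bases. If $$n>2\bigl((2\kappa(n)+2\beta(n)+1)^2+\beta(n)\bigr),$$ then $$t(\mathcal{B})\ \ge\ n-(2\kappa(n)+2\beta(n)+1)^2-\beta(n)-2 .$$ In particular, if $\beta(n)=o(\sqrt n)$ and $\kappa(n)=o(\sqrt n)$, then there is a function $\varepsilon(n)=o(n)$,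 depending only on $\beta$ and $\kappa$, such that every matroid $M$ of rank $n$ with girth at least $n-\beta(n)+1$ and every $\kappa$-overlapping base sequence $\mathcal{B}$ of $M$ satisfy $t(\mathcal{B})\ge n-\varepsilon(n)$. -/

import Mathlib

open Filter Asymptotics

universe u

/-- The girth of a matroid: the size of a smallest circuit, and `⊤` if there are no circuits. -/
noncomputable def Matroid.girth {α : Type u} (M : Matroid α) : ℕ∞ :=
  ⨅ C ∈ {C : Set α | M.IsCircuit C}, C.encard

/-- A base sequence of a matroid of rank `n`: an `n`-tuple of bases, where `B c` is thought of as
the base with colour `c`. -/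
def IsBaseSequence {α : Type u} (M : Matroid α) {n : ℕ} (B : Fin n → Set α) : Prop :=
  M.eRank = n ∧ ∀ c, M.IsBase (B c)

/-- No element of the matroid is contained in more than `κ n` of the `n` bases. -/
def IsOverlapping {α : Type u} (M : Matroid α) (κ : ℕ → ℕ) {n : ℕ} (B : Fin n → Set α) : Prop :=
  ∀ e ∈ M.E, {c : Fin n | e ∈ B c}.ncard ≤ κ n

/-- A rainbow base: a base containing exactly one element of each colour. It is
given by its representatives: `f c ∈ B c` is the element which represents the colour `c`,
different colours have different representatives, and the representatives form a base. -/
def IsRainbowBase {α : Type u} (M : Matroid α) {n : ℕ} (B : Fin n → Set α) (f : Fin n → α) :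
    Prop :=
  (∀ c, f c ∈ B c) ∧ Function.Injective f ∧ M.IsBase (Set.range f)

/-- A set of disjoint rainbow bases: for each colour, the representatives of that colour in
different members are different. -/
def IsDisjointRainbowFamily {α : Type u} (M : Matroid α) {n : ℕ} (B : Fin n → Set α)
    (R : Finset (Fin n → α)) : Prop :=
  (∀ f ∈ R, IsRainbowBase M B f) ∧ ∀ f ∈ R, ∀ g ∈ R, f ≠ g → ∀ c, f c ≠ g c

/-- The cardinality of a largest set of disjoint rainbow bases. -/
noncomputable def rainbowNumber {α : Type u} (M : Matroid α) {n : ℕ} (B : Fin n → Set α) : ℕ :=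
  sSup {k : ℕ | ∃ R : Finset (Fin n → α), IsDisjointRainbowFamily M B R ∧ R.card = k}

/-- The maximum defining `rainbowNumber` is attained for every base sequence. -/
theorem rainbowNumber_isGreatest {α : Type u} (M : Matroid α) {n : ℕ} (B : Fin n → Set α)
    (hB : IsBaseSequence M B) :
    IsGreatest {k : ℕ | ∃ R : Finset (Fin n → α), IsDisjointRainbowFamily M B R ∧ R.card = k}
      (rainbowNumber M B) := by
  have hfin : ∀ c, (B c).Finite := by
    intro c
    have h := (hB.2 c).encard_eq_eRank
    rw [hB.1] at h
    exact Set.finite_of_encard_eq_coe h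
  have hpi : (Set.univ.pi B).Finite := Set.Finite.pi hfin
  have hbdd : BddAbove {k : ℕ | ∃ R : Finset (Fin n → α),
      IsDisjointRainbowFamily M B R ∧ R.card = k} := by
    refine ⟨hpi.toFinset.card, ?_⟩
    rintro k ⟨R, hR, rfl⟩
    refine Finset.card_le_card fun f hf => ?_
    simpa using (hR.1 f hf).1
  have hne : {k : ℕ | ∃ R : Finset (Fin n → α),
      IsDisjointRainbowFamily M B R ∧ R.card = k}.Nonempty :=
    ⟨0, ∅, ⟨by simp, by simp⟩, rfl⟩
  exact ⟨Nat.sSup_mem hne hbdd, fun k hk => le_csSup hbdd hk⟩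

/-! Rainbow functions are chosen greedily. Layers `f 0, f 1, ...`, each an injective choice of one
element per colour and pairwise disjoint in every colour, are chosen so that each layer has the
largest possible rank, even when the earlier layers may be exchanged for others of at least the same
ranks. By the girth condition every layer has rank at least `n - β`. The core is
`IsGreedyLayering.imageRank_succ_lt`: after a layer that is not a base the rank drops strictly.
Ranks can drop only `β` times in this range, so of `t + β` layers the first `t` are bases.

For the drop, let layer `p` span less than `M`, let `X` be its set of representatives, and let `V c`
be the elements of colour `c` unused by the layers up to `p`. For almost every colour `c`, the
representative in layer `p` is spanned by the others, so greediness puts `V c` into the closure of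
`X`. As `B c` spans, at least `n - r X` of its elements lie outside this closure, and all of them
occur in earlier layers. Double counting gives one earlier layer `q` with a set `Q` of `n - r X + 1`
such colours. Handing such an element to layer `p` would raise the rank there, so layer `q` cannot
be rebuilt without it from unused elements at no loss of rank. Rado's theorem turns this into a
tight set of colours avoiding `c` (`IsGreedyLayering.exists_tight`). The tight sets for `c ∈ Q`
intersect in a tight set `S` disjoint from `Q`. The unused elements of colours in `S` then have rank
at most the size of `S`, yet by `HasLargeGirth.exists_robust` they span those of almost all colours,
including `Q`. Layer `p + 1` consists of unused elements, so its rank is at most `n` minus the size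
of `Q`, which is `r X - 1`. -/

/-! ### Rank functions and Rado's theorem -/

/-- The functions on finite sets which behave like the rank function of a matroid. -/
structure IsRankFunction {α : Type u} [DecidableEq α] (r : Finset α → ℕ) : Prop where
  mono : ∀ {X Y : Finset α}, X ⊆ Y → r X ≤ r Y
  submod : ∀ X Y : Finset α, r (X ∪ Y) + r (X ∩ Y) ≤ r X + r Y
  le_card : ∀ X : Finset α, r X ≤ X.card

/-- Rado's theorem, in the form due to Welsh for arbitrary submodular functions. -/
theorem exists_transversal_of_submodular {α : Type u} [DecidableEq α] {ι : Type*} [Fintype ι]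
    [DecidableEq ι] (ρ : Finset α → ℕ) (h0 : ρ ∅ = 0)
    (mono : ∀ {X Y : Finset α}, X ⊆ Y → ρ X ≤ ρ Y)
    (submod : ∀ X Y : Finset α, ρ (X ∪ Y) + ρ (X ∩ Y) ≤ ρ X + ρ Y)
    (A : ι → Finset α) (h : ∀ T : Finset ι, T.card ≤ ρ (T.biUnion A)) :
    ∃ x : ι → α, (∀ i, x i ∈ A i) ∧ ∀ T : Finset ι, T.card ≤ ρ (T.image x) := by
  induction hN : ∑ i, (A i).card using Nat.strong_induction_on generalizing A with
  | _ N ih =>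
    by_cases hone : ∀ i, (A i).card ≤ 1
    · have hne : ∀ i, (A i).Nonempty := by
        intro i
        by_contra hi
        rw [Finset.not_nonempty_iff_eq_empty] at hi
        have := h {i}
        simp [hi, h0] at this
      choose x hx using hne
      refine ⟨x, hx, fun T => (h T).trans (mono ?_)⟩
      intro a ha
      obtain ⟨i, hi, hai⟩ := Finset.mem_biUnion.1 ha
      exact Finset.mem_image.2 ⟨i, hi, Finset.card_le_one.1 (hone i) _ (hx i) _ hai⟩
    · push Not at hone
      obtain ⟨i, hi⟩ := hone
      obtain ⟨a, ha, b, hb, hab⟩ := Finset.one_lt_card.1 hi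
      have key : ∀ a ∈ A i,
          (∀ T : Finset ι, T.card ≤ ρ (T.biUnion (Function.update A i ((A i).erase a)))) →
          ∃ x : ι → α, (∀ i, x i ∈ A i) ∧ ∀ T : Finset ι, T.card ≤ ρ (T.image x) := by
        intro a ha hT
        obtain ⟨x, hx, hxT⟩ := ih _ (by
          rw [← hN]
          refine Finset.sum_lt_sum (fun k _ => Finset.card_le_card ?_)
            ⟨i, Finset.mem_univ i, ?_⟩
          · by_cases hk : k = i
            · subst hk; simpa using Finset.erase_subset _ _
            · simp [hk]
          · simpa using Finset.card_erase_lt_of_mem ha) _ hT rfl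
        refine ⟨x, fun k => ?_, hxT⟩
        have := hx k
        by_cases hk : k = i
        · subst hk; simp at this; exact this.2
        · simpa [hk] using this
      have shape : ∀ a (T : Finset ι),
          ¬ T.card ≤ ρ (T.biUnion (Function.update A i ((A i).erase a))) →
          ∃ S : Finset ι, i ∉ S ∧ ρ (S.biUnion A ∪ (A i).erase a) ≤ S.card := by
        intro a T hT
        have hiT : i ∈ T := by
          by_contra hiT
          refine hT ((h T).trans (le_of_eq ?_))
          congr 1
          refine Finset.biUnion_congr rfl fun k hk => ?_
          rw [Function.update_of_ne]
          rintro rfl; exact hiT hk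
        refine ⟨T.erase i, Finset.notMem_erase i T, ?_⟩
        have h1 : T.biUnion (Function.update A i ((A i).erase a)) =
            (T.erase i).biUnion A ∪ (A i).erase a := by
          conv_lhs => rw [← Finset.insert_erase hiT]
          rw [Finset.biUnion_insert, Function.update_self, Finset.union_comm]
          congr 1
          refine Finset.biUnion_congr rfl fun k hk => ?_
          rw [Function.update_of_ne (Finset.ne_of_mem_erase hk)]
        rw [h1] at hT
        rw [Finset.card_erase_of_mem hiT]
        omega
      by_cases h1 : ∀ T : Finset ι,
          T.card ≤ ρ (T.biUnion (Function.update A i ((A i).erase a)))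
      · exact key a ha h1
      by_cases h2 : ∀ T : Finset ι,
          T.card ≤ ρ (T.biUnion (Function.update A i ((A i).erase b)))
      · exact key b hb h2
      exfalso
      push Not at h1 h2
      obtain ⟨T1, hT1⟩ := h1
      obtain ⟨T2, hT2⟩ := h2
      obtain ⟨S1, hi1, hS1⟩ := shape a T1 (not_le.2 hT1)
      obtain ⟨S2, hi2, hS2⟩ := shape b T2 (not_le.2 hT2)
      -- As `a ≠ b`, the union of the two sets contains all of `A i`. Submodularity would give `|S1
      -- ∪ S2| + 1 + |S1 ∩ S2| ≤ |S1| + |S2|`, so one of `a`, `b` can be deleted from `A i`.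
      have hs := submod (S1.biUnion A ∪ (A i).erase a) (S2.biUnion A ∪ (A i).erase b)
      have hU := h (insert i (S1 ∪ S2))
      have hI := h (S1 ∩ S2)
      rw [Finset.card_insert_of_notMem (by simp [hi1, hi2])] at hU
      have hU' : ρ ((insert i (S1 ∪ S2)).biUnion A) ≤
          ρ ((S1.biUnion A ∪ (A i).erase a) ∪ (S2.biUnion A ∪ (A i).erase b)) := by
        apply mono
        intro v hv
        simp only [Finset.mem_biUnion, Finset.mem_insert, Finset.mem_union,
          Finset.mem_erase] at hv ⊢
        grind
      have hI' : ρ ((S1 ∩ S2).biUnion A) ≤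
          ρ ((S1.biUnion A ∪ (A i).erase a) ∩ (S2.biUnion A ∪ (A i).erase b)) := by
        apply mono
        intro v hv
        simp only [Finset.mem_biUnion, Finset.mem_inter, Finset.mem_union] at hv ⊢
        grind
      have := Finset.card_union_add_card_inter S1 S2
      omega

namespace IsRankFunction

variable {α : Type u} [DecidableEq α] {r : Finset α → ℕ}

theorem le_add_card (hr : IsRankFunction r) (X Y : Finset α) : r (X ∪ Y) ≤ r X + Y.card := by
  have := hr.submod X Y
  have := hr.le_card Y
  omega

theorem eq_card_of_subset (hr : IsRankFunction r) {X Y : Finset α} (hY : r Y = Y.card)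
    (hXY : X ⊆ Y) : r X = X.card := by
  have h1 := hr.le_add_card X (Y \ X)
  rw [Finset.union_sdiff_of_subset hXY] at h1
  have h2 := Finset.card_sdiff_add_card_eq_card hXY
  have h3 := hr.le_card X
  omega

theorem union_le_of_insert_le (hr : IsRankFunction r) (X W : Finset α)
    (h : ∀ w ∈ W, r (insert w X) ≤ r X) : r (X ∪ W) ≤ r X := by
  induction W using Finset.induction_on with
  | empty => simp
  | insert w W hw ih =>
    have h1 := ih fun v hv => h v (Finset.mem_insert_of_mem hv)
    have h2 := h w (Finset.mem_insert_self w W)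
    have h3 := hr.submod (X ∪ W) (insert w X)
    have h4 : r X ≤ r ((X ∪ W) ∩ insert w X) := hr.mono (by
      intro v hv; simp [hv])
    have h5 : X ∪ insert w W = (X ∪ W) ∪ insert w X := by
      ext v; simp; tauto
    rw [h5]
    omega

/-- If no element of a set `L ⊆ X` lies in the closure of the rest of `X`, then removing
`L` lowers the rank by the size of `L`. -/
theorem add_card_le_of_coloops (hr : IsRankFunction r) (X L : Finset α) (hL : L ⊆ X)
    (h : ∀ a ∈ L, r (X.erase a) < r X) : r (X \ L) + L.card ≤ r X := by
  induction L using Finset.induction_on with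
  | empty => simp
  | insert a L ha ih =>
    have h1 := ih (fun v hv => hL (Finset.mem_insert_of_mem hv))
      fun v hv => h v (Finset.mem_insert_of_mem hv)
    have h2 := h a (Finset.mem_insert_self a L)
    have haX := hL (Finset.mem_insert_self a L)
    have h3 := hr.submod (X \ L) (X.erase a)
    have h4 : (X \ L) ∪ X.erase a = X := by
      ext v; simp; grind
    have h5 : (X \ L) ∩ X.erase a = X \ insert a L := by
      ext v; simp; tauto
    rw [h4, h5] at h3
    rw [Finset.card_insert_of_notMem ha]
    omega

/-- A transversal with distinct elements and nullity at most `j`. -/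
theorem exists_injective_transversal (hr : IsRankFunction r) {ι : Type*} [Fintype ι]
    [DecidableEq ι] (j : ℕ) (A : ι → Finset α)
    (h : ∀ T : Finset ι, T.card ≤ (T.biUnion A).card)
    (hj : ∀ T : Finset ι, T.card ≤ r (T.biUnion A) + j) :
    ∃ x : ι → α, (∀ i, x i ∈ A i) ∧ Function.Injective x ∧
      Fintype.card ι ≤ r (Finset.univ.image x) + j := by
  obtain ⟨x, hx, hT⟩ := exists_transversal_of_submodular
    -- This is the rank function of the elongation, whose independent sets are those of nullity at
    -- most `j`. One application of Rado's theorem thus gives both distinctness and the rank bound.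
    (fun X => min X.card (r X + j)) (by simp)
    (fun {X Y} hXY => min_le_min (Finset.card_le_card hXY)
      (Nat.add_le_add_right (hr.mono hXY) j))
    (fun X Y => by
      have h1 := Finset.card_union_add_card_inter X Y
      have h2 := hr.submod X Y
      have h3 := hr.le_add_card X (Y \ X)
      have h4 := hr.le_add_card Y (X \ Y)
      rw [Finset.union_sdiff_self_eq_union] at h3 h4
      rw [Finset.union_comm Y X] at h4
      have h5 := Finset.card_sdiff_add_card_inter X Y
      have h6 := Finset.card_sdiff_add_card_inter Y X
      rw [Finset.inter_comm Y X] at h6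
      omega)
    A (fun T => le_min (h T) (hj T))
  refine ⟨x, hx, ?_, ?_⟩
  · have h1 := (le_min_iff.1 (hT Finset.univ)).1
    exact Set.injOn_univ.1 <| by
      simpa using Finset.card_image_iff.1 (le_antisymm Finset.card_image_le h1)
  · exact (le_min_iff.1 (hT Finset.univ)).2

end IsRankFunction

/-! ### Layerings and their greedy construction -/

/-- The first `k` members of `f` are injective rainbow functions, which are pairwise disjoint in
each colour. -/
structure IsLayering {α : Type u} {n : ℕ} (B : Fin n → Finset α) (k : ℕ) (f : ℕ → Fin n → α) :
    Prop where
  injective : ∀ q < k, Function.Injective (f q)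
  mem : ∀ q < k, ∀ c, f q c ∈ B c
  ne : ∀ q < k, ∀ q' < k, q ≠ q' → ∀ c, f q c ≠ f q' c

theorem IsLayering.mono {α : Type u} {n : ℕ} {B : Fin n → Finset α} {k l : ℕ} {f : ℕ → Fin n → α}
    (hf : IsLayering B l f) (h : k ≤ l) :
    IsLayering B k f :=
  ⟨fun q hq => hf.injective q (hq.trans_le h), fun q hq => hf.mem q (hq.trans_le h),
    fun q hq q' hq' => hf.ne q (hq.trans_le h) q' (hq'.trans_le h)⟩

/-- The elements of each colour which do not occur in the first `k` layers. -/
def unusedElements {α : Type u} [DecidableEq α] {n : ℕ} (B : Fin n → Finset α) (k : ℕ)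
    (f : ℕ → Fin n → α) (c : Fin n) : Finset α :=
  B c \ (Finset.range k).image fun q => f q c

/-- The rank of the set of representatives of a rainbow function. -/
def imageRank {α : Type u} [DecidableEq α] {n : ℕ} (r : Finset α → ℕ) (x : Fin n → α) : ℕ :=
  r (Finset.univ.image x)

/-- Layerings whose sequence of ranks is greedily as large as possible. -/
def IsGreedyLayering {α : Type u} [DecidableEq α] {n : ℕ} (r : Finset α → ℕ)
    (B : Fin n → Finset α) (k : ℕ) (f : ℕ → Fin n → α) : Prop :=
  IsLayering B k f ∧ ∀ p < k, ∀ g, IsLayering B (p + 1) g →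
    (∀ q < p, imageRank r (f q) ≤ imageRank r (g q)) → imageRank r (g p) ≤ imageRank r (f p)

section

variable {α : Type u} [DecidableEq α] {n : ℕ} {B : Fin n → Finset α}

theorem mem_unusedElements {k : ℕ} {f : ℕ → Fin n → α} {c : Fin n} {v : α} :
    v ∈ unusedElements B k f c ↔ v ∈ B c ∧ ∀ q < k, f q c ≠ v := by
  simp [unusedElements]

theorem IsLayering.card_unusedElements {k : ℕ} {f : ℕ → Fin n → α} (hf : IsLayering B k f)
    (c : Fin n) : (unusedElements B k f c).card + k = (B c).card := by
  have h1 : ((Finset.range k).image fun q => f q c).card = k := by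
    rw [Finset.card_image_of_injOn, Finset.card_range]
    intro q hq q' hq' h
    by_contra hne
    exact hf.ne q (by simpa using hq) q' (by simpa using hq') hne c h
  have h2 : (Finset.range k).image (fun q => f q c) ⊆ B c := by
    intro v hv
    obtain ⟨q, hq, rfl⟩ := Finset.mem_image.1 hv
    exact hf.mem q (by simpa using hq) c
  have := Finset.card_sdiff_add_card_eq_card h2
  rwa [h1] at this

/-- A rainbow function of unused elements can be added as a further layer. -/
theorem IsLayering.update {k : ℕ} {f : ℕ → Fin n → α} (hf : IsLayering B k f)
    {x : Fin n → α} (hx : Function.Injective x) (hxU : ∀ c, x c ∈ unusedElements B k f c) :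
    IsLayering B (k + 1) (Function.update f k x) := by
  have hU := fun c => mem_unusedElements.1 (hxU c)
  refine ⟨fun q hq => ?_, fun q hq c => ?_, fun q hq q' hq' hne c => ?_⟩
  · by_cases h : q = k
    · subst h; simpa using hx
    · simpa [h] using hf.injective q (by omega)
  · by_cases h : q = k
    · subst h; simpa using (hU c).1
    · simpa [h] using hf.mem q (by omega) c
  · by_cases h : q = k
    · subst h
      simpa [hne.symm] using ((hU c).2 q' (by omega)).symm
    · by_cases h' : q' = k
      · subst h'
        simpa [h] using (hU c).2 q (by omega)
      · simpa [h, h'] using hf.ne q (by omega) q' (by omega) hne c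

/-- If no element has more than `k` colours, then large subsets of the colour classes have large
unions. -/
theorem card_mul_le_of_overlap {κ m : ℕ} (hκ : ∀ e, (Finset.univ.filter fun c => e ∈ B c).card ≤ κ)
    {V : Fin n → Finset α} (hVB : ∀ c, V c ⊆ B c) (hV : ∀ c, m ≤ (V c).card)
    (T : Finset (Fin n)) : T.card * m ≤ (T.biUnion V).card * κ := by
  refine Finset.card_mul_le_card_mul (fun c e => e ∈ V c) (fun c hc => ?_) fun e _ => ?_
  · refine (hV c).trans (Finset.card_le_card fun v hv => ?_)
    simp only [Finset.bipartiteAbove, Finset.mem_filter, Finset.mem_biUnion]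
    exact ⟨⟨c, hc, hv⟩, hv⟩
  · refine (Finset.card_le_card fun c hc => ?_).trans (hκ e)
    simp only [Finset.bipartiteBelow, Finset.mem_filter] at hc
    simpa using hVB c hc.2

theorem card_le_card_biUnion_of_overlap {κ : ℕ} (hκ0 : 0 < κ)
    (hκ : ∀ e, (Finset.univ.filter fun c => e ∈ B c).card ≤ κ)
    {V : Fin n → Finset α} (hVB : ∀ c, V c ⊆ B c) (hV : ∀ c, κ ≤ (V c).card)
    (T : Finset (Fin n)) : T.card ≤ (T.biUnion V).card :=
  Nat.le_of_mul_le_mul_right (card_mul_le_of_overlap hκ hVB hV T) hκ0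

theorem unusedElements_subset (k : ℕ) (f : ℕ → Fin n → α) (c : Fin n) :
    unusedElements B k f c ⊆ B c := Finset.sdiff_subset

/-- The bound on `k` leaves at least `κ` unused elements of each colour, so Hall's condition
provides a next layer. The best one exists because ranks are at most `n`. -/
theorem exists_isGreedyLayering {r : Finset α → ℕ} (hn : ∀ X, r X ≤ n) {κ : ℕ} (hκ0 : 0 < κ)
    (hκ : ∀ e, (Finset.univ.filter fun c => e ∈ B c).card ≤ κ)
    (hB : ∀ c, (B c).card = n) (k : ℕ) (hk : k + κ ≤ n) :
    ∃ f, IsGreedyLayering r B k f := by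
  induction k with
  | zero =>
    have : Nonempty α := by
      have h := hB ⟨0, by omega⟩
      obtain ⟨a, -⟩ := Finset.card_pos.1 (h.symm ▸ (by omega : 0 < n))
      exact ⟨a⟩
    exact ⟨fun _ _ => Classical.arbitrary α, ⟨by simp, by simp, by simp⟩, by simp⟩
  | succ k ih =>
    obtain ⟨f, hf, hopt⟩ := ih (by omega)
    obtain ⟨x, hx, hxU⟩ := (Finset.all_card_le_biUnion_card_iff_exists_injective
      (unusedElements B k f)).1 fun T => card_le_card_biUnion_of_overlap hκ0 hκ
        (unusedElements_subset k f) (fun c => by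
          have := hf.card_unusedElements c
          rw [hB c] at this
          omega) T
    let P : ℕ → Prop := fun s => ∃ g, IsLayering B (k + 1) g ∧
      (∀ q < k, imageRank r (f q) ≤ imageRank r (g q)) ∧ imageRank r (g k) = s
    have hP : ∃ s, P s := ⟨_, Function.update f k x, hf.update hx hxU, fun q hq => by
      simp [hq.ne], rfl⟩
    have hbdd : ∀ s, P s → s ≤ n := by
      rintro s ⟨g, -, -, rfl⟩
      exact hn _
    obtain ⟨s, ⟨g, hg, hfg, rfl⟩, hmax⟩ : ∃ s, P s ∧ ∀ s', P s' → s' ≤ s := by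
      classical
      obtain ⟨s, hs⟩ := hP
      exact ⟨Nat.findGreatest P n, Nat.findGreatest_spec (hbdd s hs) hs,
        fun s' hs' => Nat.le_findGreatest (hbdd s' hs') hs'⟩
    refine ⟨g, hg, fun p hp g' hg' hgg' => ?_⟩
    rcases Nat.lt_succ_iff_lt_or_eq.1 hp with hp | rfl
    -- The earlier layers of `g` may differ from those of `f`, but their ranks are no smaller, so a
    -- competitor of `g` is also one of `f`.
    · exact (hopt p hp g' hg' fun q hq => (hfg q (hq.trans hp)).trans (hgg' q hq)).trans (hfg p hp)
    · exact hmax _ ⟨g', hg', fun q hq => (hfg q hq).trans (hgg' q hq), rfl⟩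

end

/-! ### Exchanges, tight sets and the girth condition -/

section

variable {α : Type u} [DecidableEq α] {n : ℕ} {B : Fin n → Finset α} {r : Finset α → ℕ}

/-- A rank function on finite sets satisfying the girth condition: sets of at most `n - β`
elements are independent, and the rank is at most `n`. -/
structure HasLargeGirth (r : Finset α → ℕ) (n β : ℕ) : Prop extends IsRankFunction r where
  le_rank : ∀ X, r X ≤ n
  eq_card : ∀ X : Finset α, X.card + β ≤ n → r X = X.card

theorem HasLargeGirth.le_of_le_card {β s : ℕ} (hr : HasLargeGirth r n β) {X : Finset α}
    (hs : s ≤ X.card) (hsn : s + β ≤ n) : s ≤ r X := by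
  obtain ⟨Y, hYX, hY⟩ := Finset.exists_subset_card_eq hs
  have h1 := hr.eq_card Y (by omega)
  have h2 := hr.mono hYX
  omega

/-- Each colour outside `S` contributes at most one to the rank. Thus the deficiency `|S| - r
(S.image x)` is largest on the set of all colours. -/
theorem IsRankFunction.imageRank_add_card_le (hr : IsRankFunction r) (x : Fin n → α)
    (S : Finset (Fin n)) : imageRank r x + S.card ≤ r (S.image x) + n := by
  have h1 := hr.le_add_card (S.image x) (Sᶜ.image x)
  rw [← Finset.image_union, Finset.union_compl] at h1
  have h2 : (Sᶜ.image x).card ≤ Sᶜ.card := Finset.card_image_le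
  have h3 := Finset.card_add_card_compl S
  rw [Fintype.card_fin] at h3
  unfold imageRank
  omega

theorem injective_update_of_imageRank_lt {x : Fin n → α}
    (hx : Function.Injective x) {c : Fin n} {b : α}
    (hb : imageRank r x < r (insert b (Finset.univ.image x))) :
    Function.Injective (Function.update x c b) := by
  have hbx : ∀ d, x d ≠ b := by
    rintro d rfl
    rw [Finset.insert_eq_of_mem (by simp)] at hb
    exact lt_irrefl _ hb
  intro d e hde
  by_cases hd : d = c <;> by_cases he : e = c
  · rw [hd, he]
  · subst hd; simp [he] at hde; exact (hbx e hde.symm).elim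
  · subst he; simp [hd] at hde; exact (hbx d hde).elim
  · simpa [hd, he, hx.eq_iff] using hde

/-- Replacing a representative in the closure of the others by an element outside of the closure
of all representatives raises the rank. -/
theorem IsRankFunction.imageRank_lt_update (hr : IsRankFunction r) {x : Fin n → α}
    {c : Fin n} {b : α} (hc : imageRank r x ≤ r ((Finset.univ.erase c).image x))
    (hb : imageRank r x < r (insert b (Finset.univ.image x))) :
    imageRank r x < imageRank r (Function.update x c b) := by
  have h1 := hr.submod (insert b ((Finset.univ.erase c).image x)) (Finset.univ.image x)
  have h2 : insert b (Finset.univ.image x) ⊆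
      insert b ((Finset.univ.erase c).image x) ∪ Finset.univ.image x := by
    intro v; simp; tauto
  have h3 : (Finset.univ.erase c).image x ⊆
      insert b ((Finset.univ.erase c).image x) ∩ Finset.univ.image x := by
    intro v; simp; grind
  have h4 : insert b ((Finset.univ.erase c).image x) ⊆
      Finset.univ.image (Function.update x c b) := by
    intro v hv
    rcases Finset.mem_insert.1 hv with rfl | hv
    · exact Finset.mem_image.2 ⟨c, by simp⟩
    · obtain ⟨d, hd, rfl⟩ := Finset.mem_image.1 hv
      exact Finset.mem_image.2 ⟨d, by simp [Finset.ne_of_mem_erase hd]⟩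
  have := hr.mono h2
  have := hr.mono h3
  have := hr.mono h4
  unfold imageRank at *
  omega

/-- Otherwise `v` could replace the redundant representative `f p c`, raising the rank of layer `p`
with the earlier layers unchanged. -/
theorem IsGreedyLayering.insert_unused_le {k p : ℕ} {f : ℕ → Fin n → α}
    (hr : IsRankFunction r) (hf : IsGreedyLayering r B k f) (hp : p < k) {c : Fin n}
    (hc : imageRank r (f p) ≤ r ((Finset.univ.erase c).image (f p))) {v : α}
    (hv : v ∈ unusedElements B (p + 1) f c) :
    r (insert v (Finset.univ.image (f p))) ≤ imageRank r (f p) := by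
  by_contra! hlt
  obtain ⟨hvB, hvf⟩ := mem_unusedElements.1 hv
  have h := hf.2 p hp (Function.update f p (Function.update (f p) c v))
    ((hf.1.mono hp.le).update (injective_update_of_imageRank_lt (hf.1.injective p hp) hlt) fun d => by
      refine mem_unusedElements.2 ?_
      by_cases hd : d = c
      · subst hd
        simpa using ⟨hvB, fun q hq => hvf q (by omega)⟩
      · simpa [hd] using ⟨hf.1.mem p hp d, fun q hq => hf.1.ne q (by omega) p hp hq.ne d⟩)
    fun q hq => by simp [hq.ne]
  rw [Function.update_self] at h
  exact absurd (hr.imageRank_lt_update hc hlt) (not_lt.2 h)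

/-- If a representative of an earlier layer lies outside of the closure of layer `p`, then
this element cannot be given up by the earlier layer, so that the unused elements of almost all
colours lie in the span of few representatives of that layer. -/
theorem IsGreedyLayering.exists_tight {k p q β κ : ℕ} {f : ℕ → Fin n → α}
    (hr : HasLargeGirth r n β) (hκ0 : 0 < κ)
    (hκ : ∀ e, (Finset.univ.filter fun c => e ∈ B c).card ≤ κ)
    (hf : IsGreedyLayering r B k f) (hp : p < k) (hqp : q < p)
    (hV : ∀ c, κ ≤ (unusedElements B (p + 1) f c).card) {c : Fin n}
    (hc : imageRank r (f p) ≤ r ((Finset.univ.erase c).image (f p)))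
    (hb : imageRank r (f p) < r (insert (f q c) (Finset.univ.image (f p)))) :
    ∃ T : Finset (Fin n), c ∉ T ∧ n ≤ T.card + β ∧
      r (T.image (f q) ∪ T.biUnion (unusedElements B (p + 1) f)) + n ≤
        T.card + imageRank r (f q) := by
  set V := unusedElements B (p + 1) f
  have hVcard : ∀ T : Finset (Fin n), T.card ≤ (T.biUnion V).card :=
    card_le_card_biUnion_of_overlap hκ0 hκ (unusedElements_subset (p + 1) f) hV
  -- The candidates for rebuilding layer `q`: colour `c` must give up `f q c`, while any other
  -- colour may keep its representative or take an unused element.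
  let A : Fin n → Finset α := fun d => if d = c then V c else insert (f q d) (V d)
  have hVA : ∀ d, V d ⊆ A d := by
    intro d
    by_cases hd : d = c
    · subst hd; simp [A]
    · simp [A, hd]
  have hfq : imageRank r (f q) ≤ n := hr.le_rank (Finset.univ.image (f q))
  have hqk := hqp.trans hp
  by_cases hrado : ∀ T : Finset (Fin n),
      T.card ≤ r (T.biUnion A) + (n - imageRank r (f q))
  · exfalso
    obtain ⟨x, hxA, hx, hxr⟩ := hr.exists_injective_transversal (n - imageRank r (f q)) A
      (fun T => (hVcard T).trans (Finset.card_le_card (Finset.biUnion_mono fun d _ => hVA d))) hrado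
    have hx' : ∀ d, x d ∈ V d ∨ d ≠ c ∧ x d = f q d := by
      intro d
      have := hxA d
      by_cases hd : d = c
      · subst hd; simp [A] at this; exact Or.inl this
      · simp only [A, hd, if_false, Finset.mem_insert] at this
        tauto
    have hxU : ∀ d, x d ∈ B d ∧ (∀ q' ≤ p, q' ≠ q → f q' d ≠ x d) ∧ (d = c → x d ≠ f q d) := by
      intro d
      rcases hx' d with h | ⟨hd, h⟩
      · obtain ⟨h1, h2⟩ := mem_unusedElements.1 h
        exact ⟨h1, fun q' hq' _ => h2 q' (by omega), fun _ => (h2 q (by omega)).symm⟩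
      · rw [h]
        exact ⟨hf.1.mem q hqk d, fun q' hq' hne => hf.1.ne q' (by omega) q hqk hne d,
          fun h' => absurd h' hd⟩
    let y := Function.update (f p) c (f q c)
    have hlay : IsLayering B (p + 1) (Function.update (Function.update f q x) p y) := by
      have hlay1 : IsLayering B p (Function.update f q x) := by
        refine ⟨fun q' hq' => ?_, fun q' hq' d => ?_, fun q1 hq1 q2 hq2 hne d => ?_⟩
        · by_cases h : q' = q
          · subst h; simpa using hx
          · simpa [h] using hf.1.injective q' (by omega)
        · by_cases h : q' = q
          · subst h; simpa using (hxU d).1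
          · simpa [h] using hf.1.mem q' (by omega) d
        · by_cases h1 : q1 = q
          · subst h1
            simpa [hne.symm] using ((hxU d).2.1 q2 hq2.le hne.symm).symm
          · by_cases h2 : q2 = q
            · subst h2
              simpa [h1] using (hxU d).2.1 q1 hq1.le h1
            · simpa [h1, h2] using hf.1.ne q1 (by omega) q2 (by omega) hne d
      refine hlay1.update (injective_update_of_imageRank_lt (hf.1.injective p hp) hb) fun d =>
        mem_unusedElements.2 ⟨?_, fun q' hq' => ?_⟩
      · by_cases hd : d = c
        · subst hd; simpa [y] using hf.1.mem q hqk d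
        · simpa [y, hd] using hf.1.mem p hp d
      · by_cases hd : d = c
        · subst hd
          by_cases h : q' = q
          · subst h; simpa [y] using (hxU d).2.2 rfl
          · simpa [y, h] using hf.1.ne q' (by omega) q hqk h d
        · by_cases h : q' = q
          · subst h; simpa [y, hd] using ((hxU d).2.1 p le_rfl (by omega)).symm
          · simpa [y, hd, h] using hf.1.ne q' (by omega) p hp (by omega) d
    have h := hf.2 p hp _ hlay fun q' hq' => by
      by_cases h : q' = q
      · subst h
        simp only [Function.update_of_ne hq'.ne, Function.update_self]
        rw [Fintype.card_fin] at hxr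
        unfold imageRank at hxr hfq ⊢
        omega
      · simp [hq'.ne, h]
    rw [Function.update_self] at h
    exact absurd (hr.imageRank_lt_update hc hb) (not_lt.2 h)
  · push Not at hrado
    obtain ⟨T, hT⟩ := hrado
    -- Without `c`, the old layer `q` already meets Rado's condition with the permitted loss of
    -- rank.
    have hcT : c ∈ T := by
      by_contra hcT
      have h1 := hr.imageRank_add_card_le (f q) T
      have h2 : r (T.image (f q)) ≤ r (T.biUnion A) := by
        refine hr.mono fun v hv => ?_
        obtain ⟨d, hd, rfl⟩ := Finset.mem_image.1 hv
        have hdc : d ≠ c := by rintro rfl; exact hcT hd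
        exact Finset.mem_biUnion.2 ⟨d, hd, by simp [A, hdc]⟩
      unfold imageRank at *
      omega
    have hcard := Finset.card_erase_add_one hcT
    refine ⟨T.erase c, Finset.notMem_erase c T, ?_, ?_⟩
    -- A smaller `T` cannot violate Rado's condition, since sets of at most `n - β` elements are
    -- independent.
    · by_contra hlt
      have h1 := hr.le_of_le_card (s := T.card) (hVcard T) (by omega)
      have h2 : r (T.biUnion V) ≤ r (T.biUnion A) :=
        hr.mono (Finset.biUnion_mono fun d _ => hVA d)
      omega
    · have h2 : r ((T.erase c).image (f q) ∪ (T.erase c).biUnion V) ≤ r (T.biUnion A) := by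
        refine hr.mono (Finset.union_subset (fun v hv => ?_) ?_)
        · obtain ⟨d, hd, rfl⟩ := Finset.mem_image.1 hv
          exact Finset.mem_biUnion.2 ⟨d, Finset.mem_of_mem_erase hd, by
            simp [A, Finset.ne_of_mem_erase hd]⟩
        · exact (Finset.biUnion_subset_biUnion_of_subset_left V (Finset.erase_subset c T)).trans
            (Finset.biUnion_mono fun d _ => hVA d)
      unfold imageRank at *
      omega

/-- The intersection of tight sets of colours of the same layer is tight. -/
theorem IsRankFunction.tight_inf (hr : IsRankFunction r) (x : Fin n → α) (P : Finset α)
    {ι : Type*} [DecidableEq ι] (Q : Finset ι) (hQ : Q.Nonempty) (T : ι → Finset (Fin n))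
    (h : ∀ i ∈ Q, r ((T i).image x ∪ P) + n ≤ (T i).card + imageRank r x) :
    r ((Q.inf T).image x ∪ P) + n ≤ (Q.inf T).card + imageRank r x := by
  induction hQ using Finset.Nonempty.cons_induction with
  | singleton i => simpa using h
  | cons i Q hi hQ ih =>
    have h1 := ih fun k hk => h k (Finset.mem_cons_of_mem hk)
    have h2 := h i (Finset.mem_cons_self i Q)
    rw [Finset.inf_cons]
    set S := Q.inf T
    have h3 := hr.submod ((T i).image x ∪ P) (S.image x ∪ P)
    have h4 : r ((T i ∪ S).image x) ≤ r (((T i).image x ∪ P) ∪ (S.image x ∪ P)) := by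
      refine hr.mono fun v hv => ?_
      simp only [Finset.mem_image, Finset.mem_union] at hv ⊢
      grind
    have h5 : r ((T i ⊓ S).image x ∪ P) ≤ r (((T i).image x ∪ P) ∩ (S.image x ∪ P)) := by
      refine hr.mono fun v hv => ?_
      simp only [Finset.mem_image, Finset.mem_union, Finset.mem_inter, Finset.inf_eq_inter] at hv ⊢
      grind
    -- Tight sets attain the maximal deficiency even with `P` adjoined. The union cannot exceed this
    -- maximum, so by submodularity the intersection attains it.
    have h6 := hr.imageRank_add_card_le x (T i ∪ S)
    have h7 := Finset.card_union_add_card_inter (T i) S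
    rw [← Finset.inf_eq_inter] at h7
    omega

/-- All but few colours of a layer which is not a base are represented by an element in the
closure of the other representatives. -/
theorem HasLargeGirth.card_noncoloops {β : ℕ} (hr : HasLargeGirth r n β) {x : Fin n → α}
    (hx : Function.Injective x) (hxn : imageRank r x < n) :
    n ≤ (Finset.univ.filter fun c : Fin n =>
      imageRank r x ≤ r ((Finset.univ.erase c).image x)).card + β := by
  by_contra! hlt
  set C := Finset.univ.filter fun c : Fin n =>
      imageRank r x ≤ r ((Finset.univ.erase c).image x)
  -- If `C` had fewer than `n - β` colours, its representatives would be independent. Together with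
  -- the coloops they would give rank `n`.
  have h1 := hr.add_card_le_of_coloops (Finset.univ.image x) (Cᶜ.image x)
    (Finset.image_subset_image (Finset.subset_univ _)) (by
      intro a ha
      obtain ⟨c, hc, rfl⟩ := Finset.mem_image.1 ha
      rw [← Finset.image_erase hx]
      refine not_le.1 fun h => Finset.mem_compl.1 hc ?_
      exact Finset.mem_filter.2 ⟨Finset.mem_univ c, h⟩)
  rw [← Finset.image_sdiff _ _ hx, Finset.card_image_of_injective _ hx] at h1
  have h2 : (Finset.univ \ Cᶜ : Finset (Fin n)) = C := by ext; simp
  rw [h2, hr.eq_card _ (by rw [Finset.card_image_of_injective _ hx]; omega),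
    Finset.card_image_of_injective _ hx] at h1
  have h3 := Finset.card_add_card_compl C
  rw [Fintype.card_fin] at h3
  unfold imageRank at hxn
  omega

/-- A small set of colours can be discarded such that discarding few more colours does not change
the span of the remaining elements. -/
theorem HasLargeGirth.exists_robust {β : ℕ} (hr : HasLargeGirth r n β) (V : Fin n → Finset α)
    (hV : ∀ T : Finset (Fin n), n ≤ 2 * T.card → n ≤ (T.biUnion V).card)
    (hn : 2 * (β * (β + 1)) ≤ n) (hβ : β ≤ n) :
    ∃ E : Finset (Fin n), E.card ≤ β * (β + 1) ∧
      ∀ D : Finset (Fin n), D.card ≤ β → r (Eᶜ.biUnion V) ≤ r ((E ∪ D)ᶜ.biUnion V) := by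
  by_contra! hno
  -- Each failure discards at most `β` more colours and loses rank. After `β + 1` failures the rank
  -- is below `n - β`, although at least half of the colours remain.
  have step : ∀ k ≤ β + 1, ∃ E : Finset (Fin n), E.card ≤ β * k ∧ r (Eᶜ.biUnion V) + k ≤ n := by
    intro k hk
    induction k with
    | zero => exact ⟨∅, by simp, by simpa using hr.le_rank _⟩
    | succ k ih =>
      obtain ⟨E, hE, hEr⟩ := ih (by omega)
      obtain ⟨D, hD, hDr⟩ := hno E (hE.trans (Nat.mul_le_mul_left _ (by omega)))
      have h1 := Finset.card_union_le E D
      exact ⟨E ∪ D, by rw [Nat.mul_succ]; omega, by omega⟩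
  obtain ⟨E, hE, hEr⟩ := step (β + 1) le_rfl
  have h1 := Finset.card_add_card_compl E
  rw [Fintype.card_fin] at h1
  have h2 := hr.le_of_le_card (s := n - β) ((Nat.sub_le _ _).trans (hV Eᶜ (by omega))) (by omega)
  omega

/-- In an independent set of size `n`, the closure of a set of smaller rank misses many
elements. -/
theorem IsRankFunction.le_card_filter_insert (hr : IsRankFunction r) {W : Finset α}
    (hW : r W = W.card) (X : Finset α) :
    W.card ≤ r X + (W.filter fun b => r X < r (insert b X)).card := by
  have h1 := hr.union_le_of_insert_le X (W.filter fun b => ¬ r X < r (insert b X)) fun w hw => by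
    simpa using (Finset.mem_filter.1 hw).2
  have h2 := hr.eq_card_of_subset hW (Finset.filter_subset (fun b => ¬ r X < r (insert b X)) W)
  have h3 := hr.mono (Finset.subset_union_right (s₁ := X)
    (s₂ := W.filter fun b => ¬ r X < r (insert b X)))
  have h4 := Finset.card_filter_add_card_filter_not (s := W) (fun b => r X < r (insert b X))
  omega

end

/-! ### The drop in rank after a layer that is not a base -/

section

variable {α : Type u} [DecidableEq α] {n : ℕ} {B : Fin n → Finset α} {r : Finset α → ℕ}

/-- In a greedy layering, two consecutive layers which are not bases have different ranks. -/
theorem IsGreedyLayering.imageRank_succ_lt {k p β κ : ℕ} {f : ℕ → Fin n → α}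
    (hr : HasLargeGirth r n β) (hκ0 : 0 < κ)
    (hκ : ∀ e, (Finset.univ.filter fun c => e ∈ B c).card ≤ κ)
    (hB : ∀ c, (B c).card = n) (hBr : ∀ c, r (B c) = n)
    (hf : IsGreedyLayering r B k f) (hp : p + 1 < k)
    (hpκ : p + 1 + 2 * κ ≤ n) (hn : 2 * ((β + 1) * (β + 1)) ≤ n)
    (hpβ : p + β + β * (β + 1) < n) (hlt : imageRank r (f p) < n) :
    imageRank r (f (p + 1)) < imageRank r (f p) := by
  by_contra! hge
  set V := unusedElements B (p + 1) f
  have hlay := hf.1.mono hp.le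
  have hVcard : ∀ c, 2 * κ ≤ (V c).card := fun c => by
    have : (V c).card + (p + 1) = (B c).card := hlay.card_unusedElements c
    rw [hB c] at this
    omega
  have hVT : ∀ T : Finset (Fin n), n ≤ 2 * T.card → n ≤ (T.biUnion V).card := fun T hT => by
    have h := card_mul_le_of_overlap hκ (unusedElements_subset (p + 1) f) hVcard T
    refine Nat.le_of_mul_le_mul_right ?_ hκ0
    calc n * κ ≤ 2 * T.card * κ := Nat.mul_le_mul_right _ hT
      _ = T.card * (2 * κ) := by ring
      _ ≤ _ := h
  have hβn : 2 * (β * (β + 1)) ≤ n ∧ β ≤ n := by constructor <;> nlinarith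
  obtain ⟨E, hE, hErob⟩ := hr.exists_robust V hVT hβn.1 hβn.2
  set X := Finset.univ.image (f p) with hX
  have hrX : r X = imageRank r (f p) := rfl
  set C := Finset.univ.filter fun c : Fin n =>
      imageRank r (f p) ≤ r ((Finset.univ.erase c).image (f p))
  have hCcard : n ≤ C.card + β := hr.card_noncoloops (hf.1.injective p (by omega)) hlt
  let bad : ℕ → Fin n → Prop := fun q c => r X < r (insert (f q c) X)
  -- More than `p` colours remain in `C \ E`, each with at least `n - r X` bad layers among the
  -- first `p`, so some layer is bad for more than `n - r X` of them.
  have hcount : ∃ q < p, n - imageRank r (f p) < ((C \ E).filter (bad q)).card := by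
    by_contra! hno
    have h := Finset.card_mul_le_card_mul (s := C \ E) (t := Finset.range p)
      (m := n - imageRank r (f p)) (n := n - imageRank r (f p)) (fun c q => bad q c)
      (fun c hc => ?_) fun q hq => hno q (by simpa using hq)
    · have h1 := Nat.le_of_mul_le_mul_right h (by omega)
      have h2 := Finset.le_card_sdiff E C
      rw [Finset.card_range] at h1
      omega
    · have hcC : imageRank r (f p) ≤ r ((Finset.univ.erase c).image (f p)) :=
        (Finset.mem_filter.1 (Finset.mem_sdiff.1 hc).1).2
      have h1 := hr.le_card_filter_insert (W := B c) (by rw [hB, hBr]) X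
      have h2 : ((B c).filter fun b => r X < r (insert b X)) ⊆
          ((Finset.range p).bipartiteAbove (fun c q => bad q c) c).image fun q => f q c := by
        intro b hb
        obtain ⟨hbB, hb⟩ := Finset.mem_filter.1 hb
        have hbV : b ∉ unusedElements B (p + 1) f c := fun hbV =>
          absurd hb (not_lt.2 (hf.insert_unused_le hr.toIsRankFunction (by omega) hcC hbV))
        rw [mem_unusedElements] at hbV
        push Not at hbV
        obtain ⟨q, hq, rfl⟩ := hbV hbB
        have hqp : q ≠ p := by
          rintro rfl
          rw [Finset.insert_eq_of_mem (by simp [hX])] at hb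
          exact lt_irrefl _ hb
        exact Finset.mem_image.2 ⟨q, by
          simpa [Finset.bipartiteAbove] using ⟨by omega, hb⟩, rfl⟩
      have h3 := (Finset.card_le_card h2).trans Finset.card_image_le
      rw [hB] at h1
      omega
  obtain ⟨q, hqp, hq⟩ := hcount
  obtain ⟨Q, hQ, hQcard⟩ := Finset.exists_subset_card_eq (Nat.succ_le_of_lt hq)
  have hQ' : ∀ c ∈ Q, (c ∈ C ∧ c ∉ E) ∧ bad q c := fun c hc => by
    have := hQ hc
    rwa [Finset.mem_filter, Finset.mem_sdiff] at this
  have htight : ∀ c : Fin n, ∃ T : Finset (Fin n), c ∈ Q → c ∉ T ∧ n ≤ T.card + β ∧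
      r (T.image (f q) ∪ T.biUnion V) + n ≤ T.card + imageRank r (f q) := fun c => by
    by_cases hc : c ∈ Q
    · obtain ⟨⟨hcC, -⟩, hb⟩ := hQ' c hc
      obtain ⟨T, hT⟩ := hf.exists_tight hr hκ0 hκ (by omega) hqp
        (fun c => le_trans (by omega) (hVcard c)) (Finset.mem_filter.1 hcC).2 hb
      exact ⟨T, fun _ => hT⟩
    · exact ⟨∅, fun h => absurd h hc⟩
  choose T hT using htight
  set S := Q.inf T with hS
  have hQne : Q.Nonempty := Finset.card_pos.1 (by omega)
  have hSr : r (S.image (f q) ∪ S.biUnion V) + n ≤ S.card + imageRank r (f q) := by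
    refine hr.tight_inf (f q) _ Q hQne T fun c hc => ?_
    have h1 := (hT c hc).2.2
    have h2 : r ((T c).image (f q) ∪ S.biUnion V) ≤ r ((T c).image (f q) ∪ (T c).biUnion V) :=
      hr.mono (Finset.union_subset_union_right
        (Finset.biUnion_subset_biUnion_of_subset_left V (Finset.inf_le hc)))
    omega
  have hQS : Q ⊆ Sᶜ := fun c hc => by
    rw [Finset.mem_compl]
    exact fun h => (hT c hc).1 (Finset.inf_le (f := T) hc h)
  have hSV : r (S.biUnion V) ≤ r (S.image (f q) ∪ S.biUnion V) :=
    hr.mono Finset.subset_union_right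
  have hfq : imageRank r (f q) ≤ n := hr.le_rank _
  have hfp : n ≤ imageRank r (f p) + β := by
    have := hr.le_of_le_card (s := n - β) (X := X) (by
      rw [hX, Finset.card_image_of_injective _ (hf.1.injective p (by omega)), Finset.card_univ,
        Fintype.card_fin]; omega) (by omega)
    omega
  have hScard : Sᶜ.card ≤ β := by
    -- This crude bound only ensures that `S` has at least half of the colours. The rank of the
    -- unused elements is then at least `n - β`, and tightness improves the bound to `β`.
    have h1 : Sᶜ.card ≤ Q.card * β := by
      have h2 : Sᶜ ⊆ Q.biUnion fun c => (T c)ᶜ := by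
        intro d hd
        rw [Finset.mem_compl, hS, Finset.mem_inf] at hd
        push Not at hd
        obtain ⟨c, hc, hdc⟩ := hd
        exact Finset.mem_biUnion.2 ⟨c, hc, Finset.mem_compl.2 hdc⟩
      refine (Finset.card_le_card h2).trans (Finset.card_biUnion_le_card_mul _ _ _ fun c hc => ?_)
      have h3 := Finset.card_add_card_compl (T c)
      rw [Fintype.card_fin] at h3
      have := (hT c hc).2.1
      omega
    have h2 : Q.card * β ≤ (β + 1) * β := Nat.mul_le_mul_right _ (by omega)
    have h3 := Finset.card_add_card_compl S
    rw [Fintype.card_fin] at h3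
    have h4 : (β + 1) * β = β * (β + 1) := mul_comm _ _
    have h5 := hr.le_of_le_card (s := n - β) ((Nat.sub_le _ _).trans (hVT S (by omega)))
      (by omega)
    omega
  have hrob := hErob Sᶜ hScard
  -- By robustness the intersection already has the rank of `Eᶜ.biUnion V`, so adjoining the latter
  -- to `S.biUnion V` does not raise the rank.
  have hU := hr.submod (S.biUnion V) (Eᶜ.biUnion V)
  have hI : r ((E ∪ Sᶜ)ᶜ.biUnion V) ≤ r (S.biUnion V ∩ Eᶜ.biUnion V) := by
    refine hr.mono (Finset.subset_inter ?_ ?_) <;>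
    · refine Finset.biUnion_subset_biUnion_of_subset_left V fun d hd => ?_
      simp at hd ⊢
      tauto
  have hlow := hr.imageRank_add_card_le (f (p + 1)) (S ∪ Eᶜ)
  have hlow' : r ((S ∪ Eᶜ).image (f (p + 1))) ≤ r (S.biUnion V ∪ Eᶜ.biUnion V) := by
    refine hr.mono fun v hv => ?_
    obtain ⟨d, hd, rfl⟩ := Finset.mem_image.1 hv
    have hdV : f (p + 1) d ∈ V d := mem_unusedElements.2
      ⟨hf.1.mem _ hp d, fun q' hq' => hf.1.ne q' (by omega) _ hp hq'.ne d⟩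
    rw [Finset.mem_union] at hd ⊢
    exact hd.imp (fun h => Finset.mem_biUnion.2 ⟨d, h, hdV⟩)
      fun h => Finset.mem_biUnion.2 ⟨d, h, hdV⟩
  -- The colours of `Q` lie outside both `S` and `E`, so they enlarge the set of colours but not the
  -- span.
  have hcard : S.card + Q.card ≤ (S ∪ Eᶜ).card := by
    rw [← Finset.card_union_of_disjoint (Finset.disjoint_left.2 fun d hd hdQ =>
      Finset.mem_compl.1 (hQS hdQ) hd)]
    exact Finset.card_le_card (Finset.union_subset_union_right fun d hd =>
      Finset.mem_compl.2 (hQ' d hd).1.2)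
  omega

/-- The first layers of a greedy layering are bases. -/
theorem exists_layering_of_bases {β κ t : ℕ} (hr : HasLargeGirth r n β) (hκ0 : 0 < κ)
    (hκ : ∀ e, (Finset.univ.filter fun c => e ∈ B c).card ≤ κ)
    (hB : ∀ c, (B c).card = n) (hBr : ∀ c, r (B c) = n)
    (htκ : t + β + 2 * κ ≤ n) (hn : 2 * ((β + 1) * (β + 1)) ≤ n)
    (htβ : t + 2 * β + β * (β + 1) ≤ n + 1) :
    ∃ f, IsLayering B t f ∧ ∀ q < t, imageRank r (f q) = n := by
  -- The `β` extra layers leave room for the descent from a layer `q < t` of rank below `n` to an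
  -- impossible rank below `n - β`.
  obtain ⟨f, hf⟩ := exists_isGreedyLayering hr.le_rank hκ0 hκ hB (t + β) (by omega)
  refine ⟨f, hf.1.mono (by omega), fun q hq => ?_⟩
  by_contra hne
  have hlt : imageRank r (f q) < n := lt_of_le_of_ne (hr.le_rank _) hne
  have hdec : ∀ i ≤ β, imageRank r (f (q + i)) + i < n := by
    intro i hi
    induction i with
    | zero => simpa using hlt
    | succ i ih =>
      have h1 := ih (by omega)
      have h2 := hf.imageRank_succ_lt hr hκ0 hκ hB hBr (p := q + i) (by omega) (by omega) hn
        (by omega) (by omega)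
      rw [← add_assoc q i 1]
      omega
  have h1 := hdec β le_rfl
  have h2 := hr.le_of_le_card (s := n - β) (X := Finset.univ.image (f (q + β))) (by
    rw [Finset.card_image_of_injective _ (hf.1.injective _ (by omega)), Finset.card_univ,
      Fintype.card_fin]; omega) (by omega)
  unfold imageRank at h1
  omega

end

/-! ### From matroids to rank functions -/

/-- The rank function of a matroid on the finite subsets of its ground set. -/
noncomputable def Matroid.finsetRank {α : Type u} (M : Matroid α) (X : Finset M.E) : ℕ :=
  (M.eRk ((↑) '' (X : Set M.E))).toNat

theorem Matroid.coe_finsetRank {α : Type u} {M : Matroid α} (X : Finset M.E) :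
    (M.finsetRank X : ℕ∞) = M.eRk ((↑) '' (X : Set M.E)) := by
  refine ENat.natCast_toNat (ne_top_of_le_ne_top ?_ (M.eRk_le_encard _))
  rw [Set.encard_ne_top_iff]
  exact X.finite_toSet.image _

theorem Matroid.encard_coe_image {α : Type u} {M : Matroid α} (X : Finset M.E) :
    (((↑) '' (X : Set M.E) : Set α)).encard = X.card := by
  rw [Subtype.val_injective.encard_image, Set.encard_coe_eq_coe_finsetCard]

theorem Matroid.isRankFunction_finsetRank {α : Type u} (M : Matroid α) [DecidableEq M.E] :
    IsRankFunction M.finsetRank where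
  mono {X Y} h := by
    have := M.eRk_mono (Set.image_mono (f := ((↑) : M.E → α)) (Finset.coe_subset.2 h))
    rw [← coe_finsetRank, ← coe_finsetRank] at this
    exact_mod_cast this
  submod X Y := by
    have := M.eRk_inter_add_eRk_union_le ((↑) '' (X : Set M.E)) ((↑) '' (Y : Set M.E))
    rw [← Set.image_inter Subtype.val_injective, ← Set.image_union, ← Finset.coe_inter,
      ← Finset.coe_union, ← coe_finsetRank, ← coe_finsetRank, ← coe_finsetRank,
      ← coe_finsetRank, add_comm] at this
    exact_mod_cast this
  le_card X := by
    have := M.eRk_le_encard ((↑) '' (X : Set M.E))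
    rw [← coe_finsetRank, encard_coe_image] at this
    exact_mod_cast this

/-- A dependent set contains a circuit, hence has more than `n - β` elements. This needs subsets of
`M.E`: a set leaving the ground set is dependent even without a circuit. -/
theorem Matroid.hasLargeGirth_finsetRank {α : Type u} {M : Matroid α} [DecidableEq M.E]
    {n β : ℕ} (hM : M.eRank = n) (hg : (n : ℕ∞) + 1 ≤ M.girth + β) :
    HasLargeGirth M.finsetRank n β where
  toIsRankFunction := M.isRankFunction_finsetRank
  le_rank X := by
    have := M.eRk_le_eRank ((↑) '' (X : Set M.E))
    rw [← coe_finsetRank, hM] at this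
    exact_mod_cast this
  eq_card X hX := by
    have hI : M.Indep ((↑) '' (X : Set M.E)) := by
      by_contra hI
      rw [not_indep_iff (by simp)] at hI
      obtain ⟨C, hCX, hC⟩ := hI.exists_isCircuit_subset
      have h1 : M.girth ≤ C.encard := iInf₂_le C hC
      have h2 := Set.encard_le_encard hCX
      rw [encard_coe_image] at h2
      have h3 : (n : ℕ∞) + 1 ≤ X.card + β := hg.trans (by gcongr; exact h1.trans h2)
      have h4 : n + 1 ≤ X.card + β := by exact_mod_cast h3
      omega
    have := hI.eRk_eq_encard
    rw [← coe_finsetRank, encard_coe_image] at this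
    exact_mod_cast this

theorem le_rainbowNumber {α : Type u} {M : Matroid α} {n : ℕ} {B : Fin n → Set α}
    (hB : IsBaseSequence M B) {R : Finset (Fin n → α)} (hR : IsDisjointRainbowFamily M B R) :
    R.card ≤ rainbowNumber M B :=
  (rainbowNumber_isGreatest M B hB).2 ⟨R, hR, rfl⟩

theorem le_rainbowNumber_of_girth {α : Type u} {M : Matroid α} {n β κ t : ℕ}
    {B : Fin n → Set α} (hg : (n : ℕ∞) + 1 ≤ M.girth + β) (hB : IsBaseSequence M B)
    (hκ : ∀ e ∈ M.E, {c : Fin n | e ∈ B c}.ncard ≤ κ)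
    (htκ : t + β + 2 * κ ≤ n) (hn0 : 0 < n) (hn : 2 * ((β + 1) * (β + 1)) ≤ n)
    (htβ : t + 2 * β + β * (β + 1) ≤ n + 1) :
    t ≤ rainbowNumber M B := by
  classical
  have hBE : ∀ c, B c ⊆ M.E := fun c => (hB.2 c).subset_ground
  have hBn : ∀ c, (B c).encard = n := fun c => by rw [(hB.2 c).encard_eq_eRank, hB.1]
  have hfin : ∀ c, ((↑) ⁻¹' B c : Set M.E).Finite := fun c =>
    (Set.finite_of_encard_eq_coe (hBn c)).preimage Subtype.val_injective.injOn
  let B' : Fin n → Finset M.E := fun c => (hfin c).toFinset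
  have hmem : ∀ c e, e ∈ B' c ↔ (e : α) ∈ B c := by simp [B']
  have himage : ∀ c, ((↑) '' (B' c : Set M.E) : Set α) = B c := fun c => by
    simp [B', Subtype.image_preimage_coe, Set.inter_eq_right.2 (hBE c)]
  have hB'card : ∀ c, (B' c).card = n := fun c => by
    have := Matroid.encard_coe_image (B' c)
    rw [himage, hBn] at this
    exact_mod_cast this.symm
  have hB'rank : ∀ c, M.finsetRank (B' c) = n := fun c => by
    have := Matroid.coe_finsetRank (B' c)
    rw [himage, (hB.2 c).eRk_eq_eRank, hB.1] at this
    exact_mod_cast this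
  have hκ' : ∀ e, (Finset.univ.filter fun c => e ∈ B' c).card ≤ κ := fun e => by
    refine le_trans (le_of_eq ?_) (hκ e e.2)
    rw [← Set.ncard_coe_finset]
    simp [hmem]
  have hκ0 : 0 < κ := by
    obtain ⟨e, he⟩ := Finset.card_pos.1 (hn0.trans_eq (hB'card ⟨0, hn0⟩).symm)
    exact (Finset.card_pos.2 ⟨⟨0, hn0⟩, by simpa using he⟩).trans_le (hκ' e)
  obtain ⟨f, hf, hfr⟩ := exists_layering_of_bases
    (Matroid.hasLargeGirth_finsetRank hB.1 hg) hκ0 hκ' hB'card hB'rank htκ hn htβ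
  let F : ℕ → Fin n → α := fun q c => f q c
  have hinj : Set.InjOn F (Finset.range t : Finset ℕ) := fun q hq q' hq' h => by
    by_contra hne
    exact hf.ne q (by simpa using hq) q' (by simpa using hq') hne ⟨0, hn0⟩
      (Subtype.ext (congrFun h ⟨0, hn0⟩))
  have hR : IsDisjointRainbowFamily M B ((Finset.range t).image F) := by
    refine ⟨fun g hg => ?_, fun g hg g' hg' hne c => ?_⟩
    · obtain ⟨q, hq, rfl⟩ := Finset.mem_image.1 hg
      rw [Finset.mem_range] at hq
      refine ⟨fun c => (hmem c _).1 (hf.mem q hq c),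
        Subtype.val_injective.comp (hf.injective q hq), ?_⟩
      have hrange : Set.range (F q) = (↑) '' ((Finset.univ.image (f q) : Finset M.E) : Set M.E) := by
        simp [F, ← Set.range_comp, Function.comp_def]
      have hrank := Matroid.coe_finsetRank (Finset.univ.image (f q))
      have hcard := Matroid.encard_coe_image (Finset.univ.image (f q))
      rw [← hrange] at hrank hcard
      rw [Finset.card_image_of_injective _ (hf.injective q hq), Finset.card_univ,
        Fintype.card_fin] at hcard
      have hq' : M.finsetRank (Finset.univ.image (f q)) = n := hfr q hq
      rw [hq'] at hrank
      have hI : M.Indep (Set.range (F q)) := by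
        rw [Matroid.indep_iff_eRk_eq_encard_of_finite (Set.finite_range _), hcard, hrank]
      have hfinrank : M.RankFinite := by
        rw [← Matroid.eRank_ne_top_iff, hB.1]
        exact ENat.natCast_ne_top n
      obtain ⟨J, hJ, hIJ⟩ := hI.exists_isBase_superset
      have : J.encard ≤ (Set.range (F q)).encard := by
        rw [hJ.encard_eq_eRank, hB.1, hcard]
      rwa [(Set.finite_range (F q)).eq_of_subset_of_encard_le hIJ this]
    · obtain ⟨q, hq, rfl⟩ := Finset.mem_image.1 hg
      obtain ⟨q', hq', rfl⟩ := Finset.mem_image.1 hg'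
      rw [Finset.mem_range] at hq hq'
      exact fun h => hf.ne q hq q' hq' (fun h => hne (by rw [h])) c (Subtype.ext h)
  have := le_rainbowNumber hB hR
  rwa [Finset.card_image_of_injOn hinj, Finset.card_range] at this

theorem le_rainbowNumber_of_overlapping (β κ : ℕ → ℕ) {α : Type u} {M : Matroid α} {n : ℕ}
    {B : Fin n → Set α} (hg : (n : ℕ∞) + 1 ≤ M.girth + (β n : ℕ∞)) (hB : IsBaseSequence M B)
    (hκ : IsOverlapping M κ B) (hn : 2 * ((2 * κ n + 2 * β n + 1) ^ 2 + β n) < n) :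
    (n : ℤ) - (2 * (κ n : ℤ) + 2 * (β n : ℤ) + 1) ^ 2 - (β n : ℤ) - 2
        ≤ (rainbowNumber M B : ℤ) := by
  have hκ0 : 0 < κ n := by
    by_contra h0
    have hn0 : 0 < n := by omega
    obtain ⟨e, he⟩ : (B ⟨0, hn0⟩).Nonempty := by
      rw [← Set.encard_pos, (hB.2 _).encard_eq_eRank, hB.1]
      exact_mod_cast hn0
    have h1 := hκ e ((hB.2 _).subset_ground he)
    have h2 : {c : Fin n | e ∈ B c}.ncard = 0 := by omega
    rw [Set.ncard_eq_zero] at h2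
    exact (Set.ext_iff.1 h2 ⟨0, hn0⟩).1 he
  have hK : (2 * κ n + 2 * β n + 1) ^ 2 =
      4 * (κ n * κ n) + 4 * (β n * β n) + 8 * (κ n * β n) + 4 * κ n + 4 * β n + 1 := by ring
  have hβ : (β n + 1) * (β n + 1) = β n * β n + 2 * β n + 1 := by ring
  have hβ' : β n * (β n + 1) = β n * β n + β n := by ring
  -- The square exceeds what is required: the preceding bound loses only a linear term in `κ n` and
  -- a quadratic one in `β n`.
  have h := le_rainbowNumber_of_girth (t := n - ((2 * κ n + 2 * β n + 1) ^ 2 + β n + 2)) hg hB hκ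
    (by omega) (by omega) (by omega) (by omega)
  have h' : n ≤ rainbowNumber M B + ((2 * κ n + 2 * β n + 1) ^ 2 + β n + 2) := by omega
  zify at h'
  linarith

/-! ### The asymptotic statement -/

theorem isLittleO_error {β κ : ℕ → ℕ}
    (hβ : (fun n : ℕ => (β n : ℝ)) =o[atTop] (fun n : ℕ => Real.sqrt (n : ℝ)))
    (hκ : (fun n : ℕ => (κ n : ℝ)) =o[atTop] (fun n : ℕ => Real.sqrt (n : ℝ))) :
    (fun n : ℕ => (2 * (κ n : ℝ) + 2 * β n + 1) ^ 2 + β n + 2) =o[atTop]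
      (fun n : ℕ => (n : ℝ)) := by
  have hcast : Tendsto (fun n : ℕ => (n : ℝ)) atTop atTop := tendsto_natCast_atTop_atTop
  have hsqrt : Tendsto (fun n : ℕ => Real.sqrt (n : ℝ)) atTop atTop :=
    Real.tendsto_sqrt_atTop.comp hcast
  have h1 : (fun _ : ℕ => (1 : ℝ)) =o[atTop] (fun n : ℕ => Real.sqrt (n : ℝ)) :=
    (isLittleO_const_left).2 (Or.inr (tendsto_norm_atTop_atTop.comp hsqrt))
  have h2 : (fun _ : ℕ => (2 : ℝ)) =o[atTop] (fun n : ℕ => (n : ℝ)) :=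
    (isLittleO_const_left).2 (Or.inr (tendsto_norm_atTop_atTop.comp hcast))
  have h3 := (((hκ.const_mul_left 2).add (hβ.const_mul_left 2)).add h1).pow two_pos
  have h4 : (fun n : ℕ => Real.sqrt (n : ℝ) ^ 2) = fun n : ℕ => (n : ℝ) :=
    funext fun n => Real.sq_sqrt n.cast_nonneg
  rw [h4] at h3
  have h5 : (fun n : ℕ => Real.sqrt (n : ℝ)) =O[atTop] (fun n : ℕ => (n : ℝ)) := by
    refine IsBigO.of_bound 1 (Eventually.of_forall fun n => ?_)
    rw [one_mul, Real.norm_of_nonneg (Real.sqrt_nonneg _), Real.norm_of_nonneg n.cast_nonneg,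
      Real.sqrt_le_iff]
    refine ⟨n.cast_nonneg, ?_⟩
    exact_mod_cast Nat.le_self_pow two_ne_zero n
  exact (h3.add (hβ.trans_isBigO h5)).add h2

/-- The girth condition `n - β n + 1 ≤ girth` is written without subtraction. -/
theorem theorem2 (β κ : ℕ → ℕ) :
    (∀ (α : Type u) (M : Matroid α) (n : ℕ) (B : Fin n → Set α),
      (n : ℕ∞) + 1 ≤ M.girth + (β n : ℕ∞) →
      IsBaseSequence M B →
      IsOverlapping M κ B →
      2 * ((2 * κ n + 2 * β n + 1) ^ 2 + β n) < n →
      (n : ℤ) - (2 * (κ n : ℤ) + 2 * (β n : ℤ) + 1) ^ 2 - (β n : ℤ) - 2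
        ≤ (rainbowNumber M B : ℤ)) ∧
    ((fun n : ℕ => (β n : ℝ)) =o[atTop] (fun n : ℕ => Real.sqrt (n : ℝ)) →
      (fun n : ℕ => (κ n : ℝ)) =o[atTop] (fun n : ℕ => Real.sqrt (n : ℝ)) →
      ∃ ε : ℕ → ℝ, ε =o[atTop] (fun n : ℕ => (n : ℝ)) ∧
        ∀ (α : Type u) (M : Matroid α) (n : ℕ) (B : Fin n → Set α),
          (n : ℕ∞) + 1 ≤ M.girth + (β n : ℕ∞) →
          IsBaseSequence M B →
          IsOverlapping M κ B →
          (n : ℝ) - ε n ≤ (rainbowNumber M B : ℝ)) := by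
  refine ⟨fun α M n B hg hB hκ hn => le_rainbowNumber_of_overlapping β κ hg hB hκ hn,
    fun hβ hκ => ?_⟩
  have herr := isLittleO_error hβ hκ
  -- Where the explicit bound is unavailable, `ε n = n` makes the claim trivial. This happens for
  -- only finitely many `n`, as the error is eventually at most `n / 2`.
  refine ⟨fun n => if 2 * ((2 * κ n + 2 * β n + 1) ^ 2 + β n) < n then
    (2 * (κ n : ℝ) + 2 * β n + 1) ^ 2 + β n + 2 else n, herr.congr' ?_ EventuallyEq.rfl,
    fun α M n B hg hB hκ => ?_⟩
  · filter_upwards [herr.bound (c := 1 / 2) (by norm_num)] with n hn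
    rw [if_pos]
    rw [Real.norm_of_nonneg (by positivity), Real.norm_of_nonneg n.cast_nonneg] at hn
    have : (2 * ((2 * κ n + 2 * β n + 1) ^ 2 + β n) : ℝ) < n := by linarith
    exact_mod_cast this
  · beta_reduce
    split_ifs with hn
    · have h := le_rainbowNumber_of_overlapping β κ hg hB hκ hn
      have h' : (n : ℝ) - (2 * (κ n : ℝ) + 2 * (β n : ℝ) + 1) ^ 2 - (β n : ℝ) - 2
        ≤ (rainbowNumber M B : ℝ) := by exact_mod_cast h
      linarith
    · simp
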